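/- Let $G$ be a torsion-free group and let $\alpha,\beta$ be non-zero elements of the group algebra $\mathbb{F}_2[G]$ such that $|\mathrm{supp}(\alpha)|=3$, $\alpha\beta=0$, and $|\mathrm{supp}(\beta')|\ge|\mathrm{supp}(\beta)|$ for every non-zero $\beta'\in\mathbb{F}_2[G]$ with $\alpha\beta'=0$. Let $Z(\alpha,\beta)$ be the zero-divisor graph of $(\alpha,\beta)$: the undirected multigraph with vertex set $\mathrm{supp}(\beta)$ and edge set $$\bigl\{\{(h,h',g,g'),(h',h,g',g)\} : h,h'\in\mathrm{supp}(\alpha),\ g,g'\in\mathrm{supp}(\beta),\ g\ne g',\ hg=h'g'\bigr\},$$ in which the edge $\{(h,h',g,g'),(h',h,g',g)\}$ joins $g$ and $g'$. For $n=2m$, the circular ladder $L_n$ ($m\ge 3$) is the simple graph with vertices $a_1,b_1,\dots,a_m,b_m$ and edges $a_ib_i$ $(1\le i\le m)$, $a_ia_{i+1}$ and $b_ib_{i+1}$ $(1\le i\le m-1)$, $a_ma_1$ and $b_mb_1$; the Möbius ladder $M_n$ ($m\ge 2$) is defined in the same way with $a_mb_1$ and $b_ma_1$ in place of $a_ma_1$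 and $b_mb_1$. An isomorphism of undirected loopless multigraphs is a pair consisting of a bijection of the vertex sets and a bijection of the edge sets, each preserving adjacency and non-adjacency (two edges are adjacent if they have a common endpoint). Then $Z(\alpha,\beta)$ is isomorphic to no circular ladder $L_n$ (even $n\ge 6$) and to no Möbius ladder $M_n$ (even $n\ge 4$). -/

import Mathlib

/-- Every element of finite order is trivial. (For nonabelian groups this is weaker than
`IsMulTorsionFree`, which asks for injectivity of the power maps.) -/
def TorsionFreeGroup (G : Type*) [Group G] : Prop :=
  ∀ g : G, IsOfFinOrder g → g = 1

/-- The zero-divisor (multi)graph `Z(α, β)`: the vertices are the elements of `supp β`, and the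
edges are the unordered pairs `{(h, h', g, g'), (h', h, g', g)}` with `h, h' ∈ supp α`,
`g, g' ∈ supp β`, `g ≠ g'` and `h g = h' g'`; such an edge joins `g` and `g'`. -/
def zeroDivisorGraph {F G : Type*} [Field F] [Group G] (α β : MonoidAlgebra F G) :
    Graph G (Sym2 (G × G × G × G)) where
  vertexSet := {g | g ∈ β.coeff.support}
  IsLink e g g' :=
    g ∈ β.coeff.support ∧ g' ∈ β.coeff.support ∧ g ≠ g' ∧
      ∃ h ∈ α.coeff.support, ∃ h' ∈ α.coeff.support,
        h * g = h' * g' ∧ e = s((h, h', g, g'), (h', h, g', g))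
  isLink_symm := by
    intro e _
    refine ⟨?_⟩
    rintro g g' ⟨hg, hg', hne, h, hh, h', hh', heq, rfl⟩
    exact ⟨hg', hg, hne.symm, h', hh', h, hh, heq.symm, Sym2.eq_swap⟩
  eq_or_eq_of_isLink_of_isLink := by
    rintro e x y v w ⟨_, _, _, h, _, h', _, _, rfl⟩ ⟨_, _, _, k, _, k', _, _, he⟩
    simp only [Sym2.eq_iff, Prod.mk.injEq] at he
    tauto
  left_mem_of_isLink := by
    rintro e x y ⟨hx, _⟩
    exact hx

/-- Two edges of a multigraph are adjacent if they have a common endpoint. -/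
def Graph.EdgeAdj {V E : Type*} (Γ : Graph V E) (e f : E) : Prop :=
  ∃ v, Γ.Inc e v ∧ Γ.Inc f v

/-- An isomorphism of (undirected, loopless) multigraphs: a bijection of the vertices and a
bijection of the edges, each preserving adjacency and non-adjacency. -/
structure Graph.Isomorphism {V E V' E' : Type*} (Γ : Graph V E) (Δ : Graph V' E') where
  /-- the bijection on vertices -/
  onVertices : Γ.vertexSet ≃ Δ.vertexSet
  /-- the bijection on edges -/
  onEdges : Γ.edgeSet ≃ Δ.edgeSet
  adj_iff : ∀ u v : Γ.vertexSet, Δ.Adj (onVertices u) (onVertices v) ↔ Γ.Adj u v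
  edgeAdj_iff : ∀ e f : Γ.edgeSet, Δ.EdgeAdj (onEdges e) (onEdges f) ↔ Γ.EdgeAdj e f

/-- The circular ladder with `m` rungs, that is `L_n` with `n = 2 m` vertices. The vertex
`(i, false)` is `a_i` and `(i, true)` is `b_i`, with `i = 0, …, m - 1`; the edges are the rungs
`a_i b_i`, the rails `a_i a_{i+1}` and `b_i b_{i+1}`, and the closing edges `a_{m-1} a_0` and
`b_{m-1} b_0`. -/
def circularLadder (m : ℕ) : SimpleGraph (Fin m × Bool) :=
  SimpleGraph.fromRel fun u v =>
    (u.1 = v.1 ∧ u.2 ≠ v.2) ∨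
    (u.1.val + 1 = v.1.val ∧ u.2 = v.2) ∨
    (u.1.val + 1 = m ∧ v.1.val = 0 ∧ u.2 = v.2)

/-- The Möbius ladder with `m` rungs, that is `M_n` with `n = 2 m` vertices: as the circular
ladder, but closed with a twist by the edges `a_{m-1} b_0` and `b_{m-1} a_0`. -/
def moebiusLadder (m : ℕ) : SimpleGraph (Fin m × Bool) :=
  SimpleGraph.fromRel fun u v =>
    (u.1 = v.1 ∧ u.2 ≠ v.2) ∨
    (u.1.val + 1 = v.1.val ∧ u.2 = v.2) ∨
    (u.1.val + 1 = m ∧ v.1.val = 0 ∧ u.2 ≠ v.2)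

/-! Write `α = h₀ + h₁ + h₂` and let `K` be the group generated by the quotients `hᵢ⁻¹ hⱼ`. As the
products `hᵢ b` with `b ∈ supp β` must cancel, for no `φ : K → ℤ` do the three values `φ (h₀⁻¹ hᵢ)`
have a maximum or a minimum attained only once; hence they are equal and `φ = 1`. So the finitely
generated torsion-free group `K` has torsion abelianization
(`torsionFreeTorsionAb_quotientSubgroup`). In such a group, a relation that makes two generators
commute, or conjugates one generator `y` to a power of itself by the other, `t`, kills a generator
(`eq_one_of_commute`, `eq_one_of_conj`), whereas the `hᵢ` are distinct.

Give an edge `h g = h' g'` the colour `h` at `g` and `h'` at `g'`. Modulo 2, none or exactly two of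
the `hᵢ⁻¹ x` lie in `supp β`, so the three neighbours of a vertex of the ladder use three different
colours (`neighbour_unique`). The square between successive rungs is then a relation of length four
in `K`, and an enumeration (`RungState.Step.classify`) leaves three kinds: relations that collapse
`K` at once, `x² = y³` (trefoil) and `x y x = y²` (twisted). Two different relations of the last two
kinds collapse `K` as well; equal relations on successive squares are settled by enumeration. The
outcome is that the colours are the same at all rungs (`RungState.eq_of_square_eq_one`). Hence
moving along a rail is multiplication by one fixed `g ≠ 1`, and since the ladder closes up, `g` has
finite order: a contradiction. -/

/-! ### Torsion-free groups whose abelianization is a torsion group -/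

/-- A torsion-free group all of whose elements have a positive power in the commutator subgroup. -/
structure TorsionFreeTorsionAb (K : Type*) [Group K] : Prop where
  eq_one_of_pow : ∀ (g : K) (n : ℕ), 0 < n → g ^ n = 1 → g = 1
  exists_pow_mem : ∀ g : K, ∃ n : ℕ, 0 < n ∧ g ^ n ∈ commutator K

namespace TorsionFreeTorsionAb

open Subgroup

variable {K : Type*} [Group K] {x y : K}

theorem eq_one_of_zpow (hK : TorsionFreeTorsionAb K) {g : K} {z : ℤ} (hz : z ≠ 0)
    (h : g ^ z = 1) : g = 1 := by
  refine hK.eq_one_of_pow g z.natAbs (Int.natAbs_pos.2 hz) ?_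
  rcases Int.natAbs_eq z with h' | h'
  · rw [h'] at h; exact_mod_cast h
  · rw [h', zpow_neg, inv_eq_one] at h; exact_mod_cast h

theorem commute_all (hgen : closure {x, y} = ⊤) {g : K} (hx : Commute g x) (hy : Commute g y)
    (k : K) : Commute g k := by
  have : closure {x, y} ≤ centralizer {g} := by
    rw [closure_le]
    rintro k (rfl | rfl)
    · exact mem_centralizer_singleton_iff.2 hx.eq.symm
    · exact mem_centralizer_singleton_iff.2 hy.eq.symm
  exact (mem_centralizer_singleton_iff.1 (this (hgen ▸ mem_top k))).symm

theorem eq_one_of_commute (hK : TorsionFreeTorsionAb K) (hgen : closure {x, y} = ⊤)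
    (h : Commute x y) : x = 1 := by
  have hx := commute_all hgen (Commute.refl x) h
  have hy := commute_all hgen h.symm (Commute.refl y)
  have hall : ∀ g k : K, Commute g k := fun g k =>
    commute_all hgen (hx g).symm (hy g).symm k
  have hbot : commutator K = ⊥ := by
    rw [eq_bot_iff, commutator_def, commutator_le]
    intro g _ k _
    rw [mem_bot, commutatorElement_eq_one_iff_mul_comm]
    exact hall g k
  obtain ⟨n, hn, hmem⟩ := hK.exists_pow_mem x
  rw [hbot, mem_bot] at hmem
  exact hK.eq_one_of_pow x n hn hmem

theorem closure_pair_eq_top {s t : K} (hgen : closure {x, y} = ⊤) (hx : x ∈ closure {s, t})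
    (hy : y ∈ closure {s, t}) : closure {s, t} = ⊤ := by
  rw [eq_top_iff, ← hgen, closure_le]
  rintro k (rfl | rfl) <;> assumption

theorem left_mem (s t : K) : s ∈ closure {s, t} := subset_closure (by simp)

theorem right_mem (s t : K) : t ∈ closure {s, t} := subset_closure (by simp)

theorem conj_pow_zpow {t y : K} {e : ℤ} (h : t⁻¹ * y * t = y ^ e) (i : ℕ) (j : ℤ) :
    (t ^ i)⁻¹ * y ^ j * t ^ i = y ^ (j * e ^ i) := by
  have h1 : ∀ j : ℤ, t⁻¹ * y ^ j * t = y ^ (j * e) := by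
    intro j
    have := conj_zpow (i := j) (a := t⁻¹) (b := y)
    rw [inv_inv, h] at this
    rw [← this, ← zpow_mul, mul_comm]
  induction i with
  | zero => simp
  | succ i ih =>
    rw [pow_succ, mul_inv_rev, pow_succ, ← mul_assoc j, ← h1, ← ih]
    group

/-- If `y` generates, under conjugation by `t`, a locally cyclic normal subgroup, and `t`, `y`
generate the group, then `t = 1`. -/
theorem eq_one_of_conj (hK : TorsionFreeTorsionAb K) {t y : K} (hgen : closure {t, y} = ⊤) (e : ℤ)
    (h : t⁻¹ * y * t = y ^ e) : t = 1 := by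
  have hlift : ∀ {g : K} {m : ℕ} {j : ℤ}, (t ^ m)⁻¹ * g * t ^ m = y ^ j → ∀ i : ℕ,
      (t ^ (m + i))⁻¹ * g * t ^ (m + i) = y ^ (j * e ^ i) := by
    intro g m j hg i
    rw [← conj_pow_zpow h, ← hg, pow_add]
    group
  -- The ascending union of the cyclic groups `t ^ m ⟨y⟩ t ^ (-m)`. It is normal and contains `y`,
  -- so `K ⧸ N` is generated by the image of `t` and the commutator subgroup lies in `N`.
  let N : Subgroup K :=
    { carrier := {g | ∃ m : ℕ, ∃ j : ℤ, (t ^ m)⁻¹ * g * t ^ m = y ^ j}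
      one_mem' := ⟨0, 0, by simp⟩
      mul_mem' := by
        rintro g g' ⟨m, j, hg⟩ ⟨m', j', hg'⟩
        refine ⟨m + m', j * e ^ m' + j' * e ^ m, ?_⟩
        have h1 := hlift hg m'
        have h2 := hlift hg' m
        rw [add_comm m' m] at h2
        rw [zpow_add, ← h1, ← h2]
        group
      inv_mem' := by
        rintro g ⟨m, j, hg⟩
        refine ⟨m, -j, ?_⟩
        rw [zpow_neg, ← hg]
        group }
  have hy : y ∈ N := ⟨0, 1, by simp⟩
  have hnorm : N.Normal := by
    rw [← normalizer_eq_top_iff, eq_top_iff, ← hgen, closure_le]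
    rintro k (rfl | rfl)
    · refine mem_normalizer_iff.2 fun g => ⟨?_, ?_⟩
      · rintro ⟨m, j, hg⟩
        refine ⟨m + 1, j, ?_⟩
        rw [← hg, add_comm, pow_add]
        group
      · rintro ⟨m, j, hg⟩
        refine ⟨m, j * e ^ 1, ?_⟩
        rw [← hlift hg 1, add_comm, pow_add]
        group
    · exact le_normalizer hy
  have hcomm : commutator K ≤ N := by
    rw [← Normal.quotient_commutative_iff_commutator_le]
    have hgen' : closure {(t : K ⧸ N), (y : K ⧸ N)} = ⊤ := by
      have := congrArg (Subgroup.map (QuotientGroup.mk' N)) hgen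
      rw [MonoidHom.map_closure, Set.image_pair,
        map_top_of_surjective _ (QuotientGroup.mk'_surjective N)] at this
      exact this
    have h1 : (y : K ⧸ N) = 1 := (QuotientGroup.eq_one_iff y).2 hy
    have ht : ∀ k, Commute (t : K ⧸ N) k :=
      commute_all hgen' (Commute.refl _) (h1 ▸ Commute.one_right _)
    have hall : ∀ g k : K ⧸ N, Commute g k := fun g k =>
      commute_all hgen' (ht g).symm (h1 ▸ Commute.one_right _) k
    exact ⟨⟨fun g k => hall g k⟩⟩
  obtain ⟨n, hn, hmem⟩ := hK.exists_pow_mem t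
  obtain ⟨m, j, hj⟩ := hcomm hmem
  have hj' : t ^ n = y ^ j := by rw [← hj]; group
  by_cases he : e = 1
  · refine hK.eq_one_of_commute hgen ?_
    rw [he, zpow_one] at h
    have : y * t = t * y := by rw [← mul_right_inj t⁻¹, ← mul_assoc, h]; group
    exact this.symm
  -- Conjugation by `t` fixes `t ^ n = y ^ j` and also raises it to the power `e ≠ 1`.
  · have h1 := conj_pow_zpow h 1 j
    have h2 : y ^ j = y ^ (j * e ^ 1) := by
      rw [← h1, ← hj']; group
    have h3 : (y ^ j) ^ (e - 1) = 1 := by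
      rw [zpow_sub_one, ← zpow_mul]
      rw [pow_one] at h2
      rw [← h2, mul_inv_cancel]
    have h4 := hK.eq_one_of_zpow (sub_ne_zero.2 he) h3
    exact hK.eq_one_of_pow t n hn (hj'.trans h4)

theorem eq_one_of_conj_inv (hK : TorsionFreeTorsionAb K) {t y : K} (hgen : closure {t, y} = ⊤)
    (e : ℤ) (h : t * y * t⁻¹ = y ^ e) : t = 1 := by
  have hgen' : closure {t⁻¹, y} = ⊤ :=
    closure_pair_eq_top hgen (inv_mem_iff.1 (left_mem t⁻¹ y)) (right_mem _ _)
  exact inv_eq_one.1 (hK.eq_one_of_conj hgen' e (by rwa [inv_inv]))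

theorem closure_swap (hgen : closure {x, y} = ⊤) : closure {y, x} = ⊤ := by
  rwa [Set.pair_comm]

/-! #### Relators of length four -/

/-- The Klein bottle group: `x` inverts `x * y` by conjugation. -/
theorem eq_one_of_mul_sq_mul_sq (hK : TorsionFreeTorsionAb K) (hgen : closure {x, y} = ⊤)
    (h : x ^ 2 * y ^ 2 = 1) : x = 1 := by
  have hgen' : closure {x, x * y} = ⊤ := by
    refine closure_pair_eq_top hgen (left_mem _ _) ?_
    have := mul_mem (inv_mem (left_mem x (x * y))) (right_mem x (x * y))
    rwa [inv_mul_cancel_left] at this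
  refine hK.eq_one_of_conj hgen' (-1) ?_
  rw [zpow_neg_one, eq_inv_iff_mul_eq_one]
  have : y * (x ^ 2 * y ^ 2) * y⁻¹ = 1 := by rw [h]; group
  rw [← this, pow_two, pow_two]; group

/-! #### Pairs of trefoil relations -/

theorem commute_of_sq_of_cube {g k : K} (h2 : Commute (g ^ 2) k) (h3 : Commute (g ^ 3) k) :
    Commute g k := by
  have : g = g ^ 3 * (g ^ 2)⁻¹ := by group
  rw [this]
  exact h3.mul_left h2.inv_left

/-- The conjugate `a b a⁻¹` equals `z² b⁻¹`. It squares to `z`, being conjugate to `b`, and to `z³`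
by centrality of `z`. -/
theorem sq_eq_one_of_quaternion {z a b c : K} (hz : ∀ k, Commute z k) (ha : a ^ 2 = z)
    (hb : b ^ 2 = z) (hc : c ^ 2 = z) (habc : a * b * c = z ^ 2) : z ^ 2 = 1 := by
  have hab : a * b = z ^ 2 * c⁻¹ := by rw [← habc]; group
  have h1 : (a * b) ^ 2 = z ^ 3 := by
    rw [hab, (((hz c⁻¹).pow_left 2)).mul_pow, inv_pow, hc]; group
  have h2 : a * b * a⁻¹ = z ^ 2 * b⁻¹ := by
    have : a * b * a⁻¹ = (a * b) ^ 2 * b⁻¹ * (a ^ 2)⁻¹ := by rw [pow_two, pow_two]; group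
    rw [this, h1, ha, mul_assoc, ((hz b⁻¹).inv_left).symm.eq]; group
  have h3 : (a * b * a⁻¹) ^ 2 = z := by
    rw [conj_pow, hb, (hz a).symm.eq]; group
  rw [h2, ((hz b⁻¹).pow_left 2).mul_pow, inv_pow, hb] at h3
  have h4 : z ^ 2 = (z ^ 2) ^ 2 * z⁻¹ * z⁻¹ := by group
  rw [h4, h3, mul_inv_cancel]

theorem trefoil_swap (hK : TorsionFreeTorsionAb K) (hgen : closure {x, y} = ⊤)
    (hA : x ^ 2 = y ^ 3) (h : y ^ 2 = x ^ 3) : x = 1 := by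
  refine hK.eq_one_of_commute hgen (commute_of_sq_of_cube ?_ ?_)
  · rw [hA]; exact (Commute.refl y).pow_left 3
  · rw [← h]; exact (Commute.refl y).pow_left 2

/-- Modulo the central element `z = x²` the relations are those of the tetrahedral group, where the
involution `x` has three conjugates under powers of `y` that form a four-group with `1`. Their lifts
satisfy the quaternion relations, whence `x⁴ = z² = 1`. -/
theorem trefoil_tetrahedral (hK : TorsionFreeTorsionAb K) (hgen : closure {x, y} = ⊤)
    (hA : x ^ 2 = y ^ 3) (h : x⁻¹ ^ 2 = (x⁻¹ * y) ^ 3) : x = 1 := by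
  have hzx : Commute (x ^ 2) x := (Commute.refl x).pow_left 2
  have hzy : Commute (x ^ 2) y := by rw [hA]; exact (Commute.refl y).pow_left 3
  have hz := commute_all hgen hzx hzy
  have hconj : ∀ g : K, (g * x * g⁻¹) ^ 2 = x ^ 2 := fun g => by
    rw [conj_pow, (hz g).symm.eq]; group
  have h1 : (y⁻¹ * x) ^ 3 = x ^ 2 := by
    have : (y⁻¹ * x) ^ 3 = ((x⁻¹ * y) ^ 3)⁻¹ := by rw [← inv_pow]; group
    rw [this, ← h]; group
  have h2 := sq_eq_one_of_quaternion hz (hconj (y ^ 2)) (hconj y) rfl (by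
    have : y ^ 2 * x * (y ^ 2)⁻¹ * (y * x * y⁻¹) * x = y ^ 3 * (y⁻¹ * x) ^ 3 := by
      rw [pow_succ (y⁻¹ * x), pow_two (y⁻¹ * x)]; group
    rw [this, h1, ← hA, ← pow_two])
  exact hK.eq_one_of_pow x 4 (by norm_num) (by rw [← h2, ← pow_mul])

theorem trefoil_cube_left (hK : TorsionFreeTorsionAb K) (hgen : closure {x, y} = ⊤)
    (hA : x ^ 2 = y ^ 3) (h : (x⁻¹ * y) ^ 2 = x⁻¹ ^ 3) : x = 1 := by
  refine hK.eq_one_of_commute hgen (commute_of_sq_of_cube ?_ ?_)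
  · rw [hA]; exact (Commute.refl y).pow_left 3
  · have h1 : Commute (x ^ 3) (x⁻¹ * y) := by
      have : x ^ 3 = ((x⁻¹ * y) ^ 2)⁻¹ := by rw [h]; group
      rw [this]; exact ((Commute.refl _).pow_left 2).inv_left
    have h2 : y = x * (x⁻¹ * y) := by group
    rw [h2]
    exact ((Commute.refl x).pow_left 3).mul_right h1

theorem trefoil_cube_right (hK : TorsionFreeTorsionAb K) (hgen : closure {x, y} = ⊤)
    (hA : x ^ 2 = y ^ 3) (h : y⁻¹ ^ 2 = (y⁻¹ * x) ^ 3) : x = 1 := by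
  refine hK.eq_one_of_commute hgen (Commute.symm (commute_of_sq_of_cube ?_ ?_))
  · have h1 : Commute (y ^ 2) (y⁻¹ * x) := by
      have : y ^ 2 = ((y⁻¹ * x) ^ 3)⁻¹ := by rw [← h]; group
      rw [this]; exact ((Commute.refl _).pow_left 3).inv_left
    have h2 : x = y * (y⁻¹ * x) := by group
    rw [h2]
    exact ((Commute.refl y).pow_left 2).mul_right h1
  · rw [← hA]; exact (Commute.refl x).pow_left 2

/-- Modulo the central element `x² = y³` the relations are dihedral, and `x` normalizes `⟨y⟩`. -/
theorem trefoil_dihedral (hK : TorsionFreeTorsionAb K) (hgen : closure {x, y} = ⊤)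
    (hA : x ^ 2 = y ^ 3) (h : (y⁻¹ * x) ^ 2 = y⁻¹ ^ 3) : x = 1 := by
  refine hK.eq_one_of_conj_inv hgen 5 ?_
  have h1 : x * y⁻¹ * x = y⁻¹ ^ 2 := by
    have : x * y⁻¹ * x = y * (y⁻¹ * x) ^ 2 := by rw [pow_two]; group
    rw [this, h]; group
  have h2 : x * y * x⁻¹ = (x * y⁻¹ * x * (x ^ 2)⁻¹)⁻¹ := by rw [pow_two]; group
  rw [h2, h1, hA]; group

theorem trefoil_twisted_same (hK : TorsionFreeTorsionAb K) (hgen : closure {x, y} = ⊤)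
    (hA : x ^ 2 = y ^ 3) (h : x * y * x = y ^ 2) : x = 1 := by
  refine hK.eq_one_of_conj_inv hgen (-1) ?_
  have h2 : x * y * x⁻¹ = x * y * x * (x ^ 2)⁻¹ := by rw [pow_two]; group
  rw [h2, h, hA]; group

/-- With `z = x²` central and `u = x⁻¹ y`, conjugation by `x` takes `u` to `u² z`. Applying it twice
is conjugation by `z`, so `u = u⁴ z³`, that is `(u z)³ = 1`; torsion-freeness gives `u z = 1` and `y
= x⁻¹`. -/
theorem trefoil_twisted_base (hK : TorsionFreeTorsionAb K) (hgen : closure {x, y} = ⊤)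
    (hA : x ^ 2 = y ^ 3) (h : x⁻¹ * (x⁻¹ * y) * x⁻¹ = (x⁻¹ * y) ^ 2) : x = 1 := by
  have hzx : Commute (x ^ 2) x := (Commute.refl x).pow_left 2
  have hzy : Commute (x ^ 2) y := by rw [hA]; exact (Commute.refl y).pow_left 3
  have hz := commute_all hgen hzx hzy
  set u := x⁻¹ * y with hu
  have h1 : x⁻¹ * u * x = u ^ 2 * x ^ 2 := by rw [← h, pow_two]; group
  have h2 : x⁻¹ * (u ^ 2 * x ^ 2) * x = u := by
    rw [← h1]
    have : x⁻¹ * (x⁻¹ * u * x) * x = (x ^ 2)⁻¹ * (u * x ^ 2) := by rw [pow_two]; group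
    rw [this, ← (hz u).eq, inv_mul_cancel_left]
  have h3 : x⁻¹ * (u ^ 2 * x ^ 2) * x = (x⁻¹ * u * x) ^ 2 * x ^ 2 := by
    rw [pow_two (x⁻¹ * u * x), pow_two u, pow_two]; group
  rw [h2, h1, ((hz (u ^ 2)).symm).mul_pow] at h3
  have h4 : (u * x ^ 2) ^ 3 = 1 := by
    rw [((hz u).symm).mul_pow]
    calc u ^ 3 * (x ^ 2) ^ 3 = u⁻¹ * ((u ^ 2) ^ 2 * (x ^ 2) ^ 2 * x ^ 2) := by group
      _ = 1 := by rw [← h3, inv_mul_cancel]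
  have h5 := hK.eq_one_of_pow _ 3 (by norm_num) h4
  have h6 : y = x⁻¹ := by
    have : y = x * (u * x ^ 2) * (x ^ 2)⁻¹ := by rw [hu]; group
    rw [this, h5, pow_two]; group
  exact hK.eq_one_of_commute hgen (h6 ▸ (Commute.refl x).inv_right)

theorem trefoil_twisted_other (hK : TorsionFreeTorsionAb K) (hgen : closure {x, y} = ⊤)
    (hA : x ^ 2 = y ^ 3) (h : y * x * y = x ^ 2) : x = 1 := by
  refine hK.eq_one_of_commute hgen (commute_of_sq_of_cube ?_ ?_)
  · rw [hA]; exact (Commute.refl y).pow_left 3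
  · have h1 : x ^ 3 = x * (y * x * y) := by rw [h]; group
    have h2 : x ^ 3 = (y * x * y) * x := by rw [h]; group
    have h3 : x ^ 3 * y = y * x ^ 3 := by
      nth_rewrite 1 [h2]
      rw [h1]; group
    exact h3

/-- Both `x³` and `y³` equal `(x y)²`, which is therefore central. Three conjugates of `x y` under
powers of `y` satisfy the quaternion relations, so `x⁶ = 1`. -/
theorem twisted_twisted (hK : TorsionFreeTorsionAb K) (hgen : closure {x, y} = ⊤)
    (h : x * y * x = y ^ 2) (h' : y * x * y = x ^ 2) : x = 1 := by
  have hx3 : x ^ 3 = (x * y) ^ 2 := by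
    calc x ^ 3 = x * x ^ 2 := by group
      _ = (x * y) ^ 2 := by rw [← h', pow_two]; group
  have hy3 : y ^ 3 = (x * y) ^ 2 := by
    calc y ^ 3 = y ^ 2 * y := by group
      _ = (x * y) ^ 2 := by rw [← h, pow_two (x * y)]; group
  have hz : ∀ k, Commute (y ^ 3) k := by
    refine commute_all hgen ?_ ((Commute.refl y).pow_left 3)
    rw [hy3, ← hx3]
    exact (Commute.refl x).pow_left 3
  have hconj : ∀ g : K, (g * (x * y) * g⁻¹) ^ 2 = y ^ 3 := fun g => by
    rw [conj_pow, ← hy3, (hz g).symm.eq]; group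
  have h2 := sq_eq_one_of_quaternion hz (hconj 1) (hconj y⁻¹) (hconj (y ^ 2)⁻¹) (by
    calc 1 * (x * y) * 1⁻¹ * (y⁻¹ * (x * y) * y⁻¹⁻¹) * ((y ^ 2)⁻¹ * (x * y) * (y ^ 2)⁻¹⁻¹)
        = x ^ 3 * y ^ 3 := by rw [pow_succ x, pow_two x]; group
      _ = (y ^ 3) ^ 2 := by rw [hx3, ← hy3, ← pow_two])
  exact hK.eq_one_of_pow x 6 (by norm_num) (by rw [← h2, hy3, ← hx3, ← pow_mul])

end TorsionFreeTorsionAb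

/-! ### Colour patterns around the squares of a ladder -/

/-- The word `(k a₁)⁻¹ (k b₁) (k a₂)⁻¹ (k b₂) ⋯` attached to a list of pairs `(aᵢ, bᵢ)`. -/
def pairWord {K : Type*} [Group K] (k : Fin 3 → K) (l : List (Fin 3 × Fin 3)) : K :=
  (l.map fun p => (k p.1)⁻¹ * k p.2).prod

/-- An injective code for pairs of colours, on which equality is fast to evaluate. -/
def pairCode (p : Fin 3 × Fin 3) : ℕ := 3 * p.1.val + p.2.val

theorem pairCode_injective : Function.Injective pairCode := by
  rintro ⟨a, b⟩ ⟨c, d⟩ h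
  simp only [pairCode] at h
  ext <;> simp only <;> omega

/-- Equality of two quadruples. -/
def quadEq (w₀ w₁ w₂ w₃ c₀ c₁ c₂ c₃ : ℕ) : Bool :=
  and (Nat.beq w₀ c₀) (and (Nat.beq w₁ c₁) (and (Nat.beq w₂ c₂) (Nat.beq w₃ c₃)))

/-- Equality of two quadruples up to cyclic rotation. -/
def quadRotEq (w₀ w₁ w₂ w₃ c₀ c₁ c₂ c₃ : ℕ) : Bool :=
  or (quadEq w₀ w₁ w₂ w₃ c₀ c₁ c₂ c₃) (or (quadEq w₁ w₂ w₃ w₀ c₀ c₁ c₂ c₃)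
    (or (quadEq w₂ w₃ w₀ w₁ c₀ c₁ c₂ c₃) (quadEq w₃ w₀ w₁ w₂ c₀ c₁ c₂ c₃)))

/-- The patterns have length four and agree up to cyclic rotation and inversion. -/
def samePattern : List (Fin 3 × Fin 3) → List (Fin 3 × Fin 3) → Bool
  | [w₀, w₁, w₂, w₃], [c₀, c₁, c₂, c₃] =>
    or (quadRotEq (pairCode w₀) (pairCode w₁) (pairCode w₂) (pairCode w₃)
        (pairCode c₀) (pairCode c₁) (pairCode c₂) (pairCode c₃))
      (quadRotEq (pairCode w₃.swap) (pairCode w₂.swap) (pairCode w₁.swap) (pairCode w₀.swap)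
        (pairCode c₀) (pairCode c₁) (pairCode c₂) (pairCode c₃))
  | _, _ => false

theorem exists_rotate_eq_of_quadRotEq {w₀ w₁ w₂ w₃ c₀ c₁ c₂ c₃ : Fin 3 × Fin 3}
    (h : quadRotEq (pairCode w₀) (pairCode w₁) (pairCode w₂) (pairCode w₃)
      (pairCode c₀) (pairCode c₁) (pairCode c₂) (pairCode c₃) = true) :
    ∃ n, [w₀, w₁, w₂, w₃].rotate n = [c₀, c₁, c₂, c₃] := by
  simp only [quadRotEq, quadEq, Bool.or_eq_true, Bool.and_eq_true, Nat.beq_eq,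
    pairCode_injective.eq_iff] at h
  rcases h with ⟨rfl, rfl, rfl, rfl⟩ | ⟨rfl, rfl, rfl, rfl⟩ | ⟨rfl, rfl, rfl, rfl⟩ |
    ⟨rfl, rfl, rfl, rfl⟩
  exacts [⟨0, rfl⟩, ⟨1, rfl⟩, ⟨2, rfl⟩, ⟨3, rfl⟩]

section PairWord

variable {K : Type*} [Group K] {k : Fin 3 → K}

theorem pairWord_rotate {w : List (Fin 3 × Fin 3)} (hw : pairWord k w = 1) (n : ℕ) :
    pairWord k (w.rotate n) = 1 := by
  rw [pairWord, List.map_rotate]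
  exact List.prod_rotate_eq_one_of_prod_eq_one hw _

theorem pairWord_reverse_swap (w : List (Fin 3 × Fin 3)) :
    pairWord k (w.map Prod.swap).reverse = (pairWord k w)⁻¹ := by
  simp only [pairWord, List.prod_inv_reverse, ← List.map_reverse, List.map_map]
  congr 2
  ext p
  simp

theorem pairWord_eq_one_of_samePattern {w c : List (Fin 3 × Fin 3)}
    (h : samePattern w c = true) (hw : pairWord k w = 1) : pairWord k c = 1 := by
  unfold samePattern at h
  split at h
  · rw [Bool.or_eq_true] at h
    rcases h with h | h
    · obtain ⟨n, hn⟩ := exists_rotate_eq_of_quadRotEq h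
      rw [← hn]
      exact pairWord_rotate hw n
    · obtain ⟨n, hn⟩ := exists_rotate_eq_of_quadRotEq h
      rw [← hn]
      refine pairWord_rotate ?_ n
      have := pairWord_reverse_swap (k := k) _ ▸ inv_eq_one.2 hw
      exact this
  · cases h

end PairWord

/-- The colours at a rung: `(r, s, q, Q)` where `r`, `s` are the colours of the rung at its two
ends and `q`, `Q` those of the rails leading back from these ends. The colours of the rails leading
forward are then `-(r + q)` and `-(s + Q)`. -/
abbrev RungState := Fin 3 × Fin 3 × Fin 3 × Fin 3

/-- The three colours at each of the two ends of a rung are distinct, and so are the two colours of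
the rung. -/
def RungState.Valid (S : RungState) : Prop :=
  S.1 ≠ S.2.1 ∧ S.2.2.1 ≠ S.1 ∧ S.2.2.2 ≠ S.2.1

instance (S : RungState) : Decidable S.Valid := inferInstanceAs (Decidable (_ ∧ _))

/-- The compatibility of the states at two successive rungs: the two colours of every rail between
them differ. -/
def RungState.Step (S T : RungState) : Prop :=
  T.2.2.1 ≠ -(S.1 + S.2.2.1) ∧ T.2.2.2 ≠ -(S.2.1 + S.2.2.2)

instance (S T : RungState) : Decidable (S.Step T) := inferInstanceAs (Decidable (_ ∧ _))

/-- The pattern of colours around the square between two successive rungs. -/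
def RungState.square (S T : RungState) : List (Fin 3 × Fin 3) :=
  [(T.2.1, T.1), (T.2.2.1, -(S.1 + S.2.2.1)), (S.1, S.2.1), (-(S.2.1 + S.2.2.2), T.2.2.2)]

/-- The patterns which force the group to be solvable. -/
def solvablePatterns (a b c : Fin 3) : List (List (Fin 3 × Fin 3)) :=
  [[(a, b), (a, b), (a, b), (a, b)],
   [(a, b), (a, b), (a, b), (a, c)],
   [(a, b), (a, b), (a, c), (a, c)],
   [(a, b), (a, c), (a, b), (a, c)],
   [(a, b), (c, a), (b, c), (a, b)],
   [(a, c), (a, c), (b, c), (a, b)],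
   [(a, b), (a, c), (b, c), (a, c)],
   [(a, b), (c, a), (b, c), (a, c)]]

/-- The pattern of the relation `x ^ 2 = y ^ 3`. -/
def trefoilPattern (a b c : Fin 3) : List (Fin 3 × Fin 3) :=
  [(a, b), (c, a), (c, a), (c, b)]

/-- The pattern of the relation `x * y * x = y ^ 2`. -/
def twistedPattern (a b c : Fin 3) : List (Fin 3 × Fin 3) :=
  [(a, b), (c, a), (c, b), (a, c)]

/-- The elements of `Fin 3` sum to zero, so `-(a + b)` is the third colour. Exchanging the outer
colours `a`, `c` of a twisted pattern only rotates it, so `a = b + 1` may be taken there. -/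
theorem RungState.Step.classify : ∀ S : RungState, S.Valid → ∀ T : RungState, T.Valid → S.Step T →
    ∃ a b : Fin 3, a ≠ b ∧
      or (samePattern (S.square T) (trefoilPattern a b (-(a + b))))
        (or (samePattern (S.square T) (twistedPattern (b + 1) b (-(b + 1 + b))))
          ((solvablePatterns a b (-(a + b))).any (samePattern (S.square T)))) = true := by
  decide +kernel

/-- The case of equal relations on successive squares, where algebra gives nothing new. Testing the
first square before `U` is quantified keeps the enumeration small. -/
theorem not_trefoil_trefoil : ∀ S : RungState, S.Valid → ∀ T : RungState, T.Valid → S.Step T →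
    ∀ a b : Fin 3, a ≠ b ∧ samePattern (S.square T) (trefoilPattern a b (-(a + b))) = true →
    ∀ U : RungState, ¬ (U.Valid ∧ T.Step U ∧
      samePattern (T.square U) (trefoilPattern a b (-(a + b))) = true) := by
  decide +kernel

/-- The one combination that algebra and the other enumeration leave open: here the first two states
must coincide. -/
theorem not_twisted_twisted : ∀ S : RungState, S.Valid → ∀ T : RungState, T.Valid → S.Step T →
    ∀ b : Fin 3,
    S ≠ T ∧ samePattern (S.square T) (twistedPattern (b + 1) b (-(b + 1 + b))) = true →
    ∀ U : RungState, ¬ (U.Valid ∧ T.Step U ∧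
      samePattern (T.square U) (twistedPattern (b + 1) b (-(b + 1 + b))) = true) := by
  decide +kernel

/-! ### Relations among three elements of a torsion-free group with torsion abelianization -/

section Relations

open Subgroup

variable {K : Type*} [Group K] {k : Fin 3 → K}

theorem closure_pair_of_closure_range
    (hgen : closure (Set.range fun p : Fin 3 × Fin 3 => (k p.1)⁻¹ * k p.2) = ⊤)
    {a b c : Fin 3} (hab : a ≠ b) (hac : a ≠ c) (hbc : b ≠ c) :
    closure {(k a)⁻¹ * k b, (k a)⁻¹ * k c} = ⊤ := by
  have h : ∀ i, (k a)⁻¹ * k i ∈ closure {(k a)⁻¹ * k b, (k a)⁻¹ * k c} := by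
    intro i
    have hi : i = a ∨ i = b ∨ i = c := by omega
    rcases hi with rfl | rfl | rfl
    · rw [inv_mul_cancel]; exact one_mem _
    · exact TorsionFreeTorsionAb.left_mem _ _
    · exact TorsionFreeTorsionAb.right_mem _ _
  rw [eq_top_iff, ← hgen, closure_le]
  rintro _ ⟨⟨i, j⟩, rfl⟩
  have := mul_mem (inv_mem (h i)) (h j)
  simpa [mul_assoc] using this

theorem inv_mul_ne_one (hinj : Function.Injective k) {a b : Fin 3} (hab : a ≠ b) :
    (k a)⁻¹ * k b ≠ 1 := fun h => hab (hinj (inv_mul_eq_one.1 h))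

/-- With `x = (k a)⁻¹ k b` and `y = (k a)⁻¹ k c` the eight relations are, in order, `x⁴ = 1`, `x³ y
= 1`, `x² y² = 1`, `(x y)² = 1`, and four Baumslag–Solitar relations conjugating one generator to
its power `2` or `-2`. -/
theorem not_solvable_pattern (hK : TorsionFreeTorsionAb K) (hinj : Function.Injective k)
    (hgen : closure (Set.range fun p : Fin 3 × Fin 3 => (k p.1)⁻¹ * k p.2) = ⊤)
    {a b c : Fin 3} (hab : a ≠ b) (hac : a ≠ c) (hbc : b ≠ c) {P : List (Fin 3 × Fin 3)}
    (hP : P ∈ solvablePatterns a b c) (h : pairWord k P = 1) : False := by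
  have hgen' := closure_pair_of_closure_range hgen hab hac hbc
  have hx := inv_mul_ne_one hinj hab
  have hy := inv_mul_ne_one hinj hac
  have hca : (k c)⁻¹ * k a = ((k a)⁻¹ * k c)⁻¹ := by group
  have hbc' : (k b)⁻¹ * k c = ((k a)⁻¹ * k b)⁻¹ * ((k a)⁻¹ * k c) := by group
  simp only [solvablePatterns, List.mem_cons, List.not_mem_nil, or_false] at hP
  rcases hP with rfl | rfl | rfl | rfl | rfl | rfl | rfl | rfl <;>
    simp only [pairWord, List.map_cons, List.map_nil, List.prod_cons, List.prod_nil, mul_one,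
      hca, hbc'] at h <;>
    generalize (k a)⁻¹ * k b = x at * <;> generalize (k a)⁻¹ * k c = y at *
  · exact hx (hK.eq_one_of_pow x 4 (by norm_num) (by simpa [pow_succ, mul_assoc] using h))
  · refine hx (hK.eq_one_of_commute hgen' ?_)
    have : y = (x ^ 3)⁻¹ := by
      rw [eq_inv_iff_mul_eq_one, mul_eq_one_comm]; simpa [pow_succ, mul_assoc] using h
    rw [this]
    exact ((Commute.refl x).pow_right 3).inv_right
  · exact hx (hK.eq_one_of_mul_sq_mul_sq hgen' (by simpa [pow_succ, mul_assoc] using h))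
  · refine hx (hK.eq_one_of_commute hgen' ?_)
    have := hK.eq_one_of_pow (x * y) 2 (by norm_num) (by simpa [pow_succ, mul_assoc] using h)
    rw [eq_inv_of_mul_eq_one_right this]
    exact (Commute.refl x).inv_right
  · refine hy (hK.eq_one_of_conj (TorsionFreeTorsionAb.closure_swap hgen') 2 ?_)
    have : y⁻¹ * x * y = x * (x * (y⁻¹ * (x⁻¹ * y * x)))⁻¹ * x := by group
    rw [this, h, zpow_ofNat, pow_two]; group
  · refine hx (hK.eq_one_of_conj hgen' (-2) ?_)
    have : x⁻¹ * y * x = y ^ (-2 : ℤ) * (y * (y * (x⁻¹ * y * x))) := by group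
    rw [this, h]; group
  · refine hx (hK.eq_one_of_conj_inv hgen' (-2) ?_)
    have : x * y * x⁻¹ = x * (y * (x⁻¹ * y * y)) * y ^ (-2 : ℤ) := by group
    rw [this, h]; group
  · refine hx (hK.eq_one_of_conj_inv hgen' 2 ?_)
    have : x * y * x⁻¹ = y ^ 2 * (x * (y⁻¹ * (x⁻¹ * y * y)))⁻¹ := by rw [pow_two]; group
    rw [this, h]; group

theorem pairWord_trefoil {a b c : Fin 3} (h : pairWord k (trefoilPattern a b c) = 1) :
    ((k a)⁻¹ * k b) ^ 2 = ((k a)⁻¹ * k c) ^ 3 := by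
  have hca : (k c)⁻¹ * k a = ((k a)⁻¹ * k c)⁻¹ := by group
  have hcb : (k c)⁻¹ * k b = ((k a)⁻¹ * k c)⁻¹ * ((k a)⁻¹ * k b) := by group
  simp only [trefoilPattern, pairWord, List.map_cons, List.map_nil, List.prod_cons, List.prod_nil,
    mul_one, hca, hcb] at h
  generalize (k a)⁻¹ * k b = x at *
  generalize (k a)⁻¹ * k c = y at *
  have : x ^ 2 = y ^ 3 * (x⁻¹ * (x * (y⁻¹ * (y⁻¹ * (y⁻¹ * x)))) * x) := by
    rw [pow_succ y, pow_two, pow_two]; group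
  rw [this, h]; group

theorem pairWord_twisted {a b c : Fin 3} (h : pairWord k (twistedPattern a b c) = 1) :
    ((k a)⁻¹ * k b) * ((k a)⁻¹ * k c) * ((k a)⁻¹ * k b) = ((k a)⁻¹ * k c) ^ 2 := by
  have hca : (k c)⁻¹ * k a = ((k a)⁻¹ * k c)⁻¹ := by group
  have hcb : (k c)⁻¹ * k b = ((k a)⁻¹ * k c)⁻¹ * ((k a)⁻¹ * k b) := by group
  simp only [twistedPattern, pairWord, List.map_cons, List.map_nil, List.prod_cons, List.prod_nil,
    mul_one, hca, hcb] at h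
  generalize (k a)⁻¹ * k b = x at *
  generalize (k a)⁻¹ * k c = y at *
  have : x * y * x = y ^ 2 * (x⁻¹ * (x * (y⁻¹ * (y⁻¹ * x * y))) * x) := by rw [pow_two]; group
  rw [this, h]; group

theorem pairWord_twisted_symm {a b c : Fin 3} (h : pairWord k (twistedPattern a b c) = 1) :
    pairWord k (twistedPattern c b a) = 1 := by
  have := pairWord_rotate h 2
  exact this

theorem ne_third {a b : Fin 3} (hab : a ≠ b) : a ≠ -(a + b) ∧ b ≠ -(a + b) := by
  decide +revert

theorem eq_or_eq_third {a b : Fin 3} (hab : a ≠ b) (i : Fin 3) : i = a ∨ i = b ∨ i = -(a + b) := by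
  decide +revert

theorem third_eq {a b c : Fin 3} (hab : a ≠ b) (hac : a ≠ c) (hbc : b ≠ c) : -(a + b) = c := by
  decide +revert

/-- Besides `(a, b)` there are five ordered pairs of distinct colours. Written in the generators
`x`, `y` of the first relation, each gives one of the five lemmas on pairs of trefoil relations. -/
theorem not_trefoil_trefoil_of_ne (hK : TorsionFreeTorsionAb K) (hinj : Function.Injective k)
    (hgen : closure (Set.range fun p : Fin 3 × Fin 3 => (k p.1)⁻¹ * k p.2) = ⊤)
    {a b a' b' : Fin 3} (hab : a ≠ b) (hab' : a' ≠ b') (hne : ¬ (a' = a ∧ b' = b))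
    (h : pairWord k (trefoilPattern a b (-(a + b))) = 1)
    (h' : pairWord k (trefoilPattern a' b' (-(a' + b'))) = 1) : False := by
  obtain ⟨hac, hbc⟩ := ne_third hab
  have ha' := eq_or_eq_third hab a'
  have hb' := eq_or_eq_third hab b'
  generalize -(a + b) = c at *
  have hgen' := closure_pair_of_closure_range hgen hab hac hbc
  have hx := inv_mul_ne_one hinj hab
  replace h := pairWord_trefoil h
  replace h' := pairWord_trefoil h'
  have hba : (k b)⁻¹ * k a = ((k a)⁻¹ * k b)⁻¹ := by group
  have hca : (k c)⁻¹ * k a = ((k a)⁻¹ * k c)⁻¹ := by group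
  have hcb : (k c)⁻¹ * k b = ((k a)⁻¹ * k c)⁻¹ * ((k a)⁻¹ * k b) := by group
  have hbc' : (k b)⁻¹ * k c = ((k a)⁻¹ * k b)⁻¹ * ((k a)⁻¹ * k c) := by group
  rcases ha' with ha' | ha' | ha' <;> rcases hb' with hb' | hb' | hb' <;> rw [ha', hb'] at h'
  · exact hab' (ha'.trans hb'.symm)
  · exact hne ⟨ha', hb'⟩
  · rw [third_eq hac hab hbc.symm] at h'
    exact hx (hK.trefoil_swap hgen' h h')
  · rw [third_eq hab.symm hbc hac, hba, hbc'] at h'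
    exact hx (hK.trefoil_tetrahedral hgen' h h')
  · exact hab' (ha'.trans hb'.symm)
  · rw [third_eq hbc hab.symm hac.symm, hba, hbc'] at h'
    exact hx (hK.trefoil_cube_left hgen' h h')
  · rw [third_eq hac.symm hbc.symm hab, hca, hcb] at h'
    exact hx (hK.trefoil_cube_right hgen' h h')
  · rw [third_eq hbc.symm hac.symm hab.symm, hca, hcb] at h'
    exact hx (hK.trefoil_dihedral hgen' h h')
  · exact hab' (ha'.trans hb'.symm)

/-- The relation of a twisted pattern depends on the middle colour only. -/
theorem pairWord_twisted_base {a b a' : Fin 3} (hab : a ≠ b) (hab' : a' ≠ b)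
    (h : pairWord k (twistedPattern a b (-(a + b))) = 1) :
    pairWord k (twistedPattern a' b (-(a' + b))) = 1 := by
  obtain ⟨hac, hbc⟩ := ne_third hab
  rcases eq_or_eq_third hab a' with rfl | rfl | ha'
  · exact h
  · exact absurd rfl hab'
  · rw [ha', third_eq hbc.symm hac.symm hab.symm]
    exact pairWord_twisted_symm h

/-- By `pairWord_twisted_base` only the middle colour `b'` matters, and each of its three values
matches one of the lemmas on a trefoil and a twisted relation. -/
theorem not_trefoil_twisted (hK : TorsionFreeTorsionAb K) (hinj : Function.Injective k)
    (hgen : closure (Set.range fun p : Fin 3 × Fin 3 => (k p.1)⁻¹ * k p.2) = ⊤)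
    {a b a' b' : Fin 3} (hab : a ≠ b) (hab' : a' ≠ b')
    (h : pairWord k (trefoilPattern a b (-(a + b))) = 1)
    (h' : pairWord k (twistedPattern a' b' (-(a' + b'))) = 1) : False := by
  obtain ⟨hac, hbc⟩ := ne_third hab
  have hb' := eq_or_eq_third hab b'
  generalize -(a + b) = c at *
  have hgen' := closure_pair_of_closure_range hgen hab hac hbc
  have hx := inv_mul_ne_one hinj hab
  replace h := pairWord_trefoil h
  rcases hb' with rfl | rfl | rfl
  · replace h' := pairWord_twisted (pairWord_twisted_base hab' hab.symm h')
    rw [third_eq hab.symm hbc hac] at h'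
    refine hx (hK.trefoil_twisted_base hgen' h ?_)
    simpa [mul_assoc] using h'
  · replace h' := pairWord_twisted (pairWord_twisted_base hab' hab h')
    rw [third_eq hab hac hbc] at h'
    exact hx (hK.trefoil_twisted_same hgen' h h')
  · replace h' := pairWord_twisted (pairWord_twisted_base hab' hac h')
    rw [third_eq hac hab hbc.symm] at h'
    exact hx (hK.trefoil_twisted_other hgen' h h')

theorem not_twisted_twisted_of_ne (hK : TorsionFreeTorsionAb K) (hinj : Function.Injective k)
    (hgen : closure (Set.range fun p : Fin 3 × Fin 3 => (k p.1)⁻¹ * k p.2) = ⊤)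
    {a b a' b' : Fin 3} (hab : a ≠ b) (hab' : a' ≠ b') (hne : b ≠ b')
    (h : pairWord k (twistedPattern a b (-(a + b))) = 1)
    (h' : pairWord k (twistedPattern a' b' (-(a' + b'))) = 1) : False := by
  obtain ⟨hcb, hcb'⟩ := ne_third hne
  have hgen' := closure_pair_of_closure_range hgen hcb.symm hcb'.symm hne
  replace h := pairWord_twisted (pairWord_twisted_base hab hcb.symm h)
  replace h' := pairWord_twisted (pairWord_twisted_base hab' hcb'.symm h')
  rw [third_eq hcb.symm hcb'.symm hne] at h
  rw [third_eq hcb'.symm hcb.symm hne.symm] at h'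
  exact inv_mul_ne_one hinj hcb.symm (hK.twisted_twisted hgen' h h')

/-- Three successive rungs whose squares are relations: the first two have the same colours. -/
theorem RungState.eq_of_square_eq_one (hK : TorsionFreeTorsionAb K) (hinj : Function.Injective k)
    (hgen : closure (Set.range fun p : Fin 3 × Fin 3 => (k p.1)⁻¹ * k p.2) = ⊤)
    {S T U : RungState} (hS : S.Valid) (hT : T.Valid) (hU : U.Valid) (hST : S.Step T)
    (hTU : T.Step U) (h : pairWord k (S.square T) = 1) (h' : pairWord k (T.square U) = 1) :
    S = T := by
  by_contra hne
  have hsucc : ∀ b : Fin 3, b + 1 ≠ b := by decide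
  have hsolv : ∀ {w : List (Fin 3 × Fin 3)} {a b : Fin 3}, a ≠ b → pairWord k w = 1 →
      (solvablePatterns a b (-(a + b))).any (samePattern w) = true → False := by
    intro w a b hab hw hany
    obtain ⟨P, hP, hwP⟩ := List.any_eq_true.1 hany
    exact not_solvable_pattern hK hinj hgen hab (ne_third hab).1 (ne_third hab).2 hP
      (pairWord_eq_one_of_samePattern hwP hw)
  obtain ⟨a, b, hab, h1⟩ := RungState.Step.classify S hS T hT hST
  obtain ⟨a', b', hab', h2⟩ := RungState.Step.classify T hT U hU hTU
  rw [Bool.or_eq_true, Bool.or_eq_true] at h1 h2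
  rcases h1 with h1 | h1 | h1
  · rcases h2 with h2 | h2 | h2
    · by_cases heq : a' = a ∧ b' = b
      · obtain ⟨rfl, rfl⟩ := heq
        exact not_trefoil_trefoil S hS T hT hST a' b' ⟨hab, h1⟩ U ⟨hU, hTU, h2⟩
      · exact not_trefoil_trefoil_of_ne hK hinj hgen hab hab' heq
          (pairWord_eq_one_of_samePattern h1 h) (pairWord_eq_one_of_samePattern h2 h')
    · exact not_trefoil_twisted hK hinj hgen hab (hsucc b')
        (pairWord_eq_one_of_samePattern h1 h) (pairWord_eq_one_of_samePattern h2 h')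
    · exact hsolv hab' h' h2
  · rcases h2 with h2 | h2 | h2
    · exact not_trefoil_twisted hK hinj hgen hab' (hsucc b)
        (pairWord_eq_one_of_samePattern h2 h') (pairWord_eq_one_of_samePattern h1 h)
    · by_cases heq : b = b'
      · subst heq
        exact not_twisted_twisted S hS T hT hST b ⟨hne, h1⟩ U ⟨hU, hTU, h2⟩
      · exact not_twisted_twisted_of_ne hK hinj hgen (hsucc b) (hsucc b') heq
          (pairWord_eq_one_of_samePattern h1 h) (pairWord_eq_one_of_samePattern h2 h')
    · exact hsolv hab' h' h2
  · exact hsolv hab h h1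

end Relations

/-! ### From annihilators in the group algebra to torsion abelianization -/

section Indicable

open Subgroup

/-- Modulo torsion the finitely generated abelianization is free, so its integral functionals
separate points. All of them vanish, hence every element of the abelianization is torsion. -/
theorem exists_pow_mem_commutator {K : Type*} [Group K] [Group.FG K]
    (hφ : ∀ φ : K →* Multiplicative ℤ, φ = 1) (g : K) :
    ∃ n : ℕ, 0 < n ∧ g ^ n ∈ commutator K := by
  have hfg : Group.FG (Abelianization K) :=
    Group.fg_of_surjective (f := Abelianization.of) (QuotientGroup.mk'_surjective _)
  have hfin : Module.Finite ℤ (Additive (Abelianization K)) := by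
    rw [Module.Finite.iff_addGroup_fg]
    infer_instance
  set T := Submodule.torsion ℤ (Additive (Abelianization K))
  have ha : T.mkQ (Additive.ofMul (Abelianization.of g)) = 0 := by
    rw [← Module.forall_dual_apply_eq_zero_iff ℤ]
    intro f
    let φ : K →* Multiplicative ℤ :=
      (AddMonoidHom.toMultiplicativeRight (f.comp T.mkQ).toAddMonoidHom).comp Abelianization.of
    have := DFunLike.congr_fun (hφ φ) g
    exact this
  rw [Submodule.mkQ_apply, Submodule.Quotient.mk_eq_zero, Submodule.mem_torsion_iff] at ha
  obtain ⟨⟨z, hz⟩, hza⟩ := ha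
  have hz0 : z ≠ 0 := nonZeroDivisors.ne_zero hz
  have h1 : (Abelianization.of g) ^ z = 1 := hza
  refine ⟨z.natAbs, Int.natAbs_pos.2 hz0, ?_⟩
  rw [← Abelianization.ker_of, MonoidHom.mem_ker, map_pow]
  rcases Int.natAbs_eq z with h' | h'
  · rw [h'] at h1; exact_mod_cast h1
  · rw [h', zpow_neg, inv_eq_one] at h1; exact_mod_cast h1

variable {G : Type*} [Group G]

/-- The subgroup generated by the quotients `(h i)⁻¹ * h j`. -/
abbrev quotientSubgroup (h : Fin 3 → G) : Subgroup G :=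
  closure (Set.range fun p : Fin 3 × Fin 3 => (h p.1)⁻¹ * h p.2)

/-- The quotient `(h i)⁻¹ * h j` as an element of the subgroup generated by these quotients. -/
def quotientElt (h : Fin 3 → G) (i j : Fin 3) : quotientSubgroup h :=
  ⟨(h i)⁻¹ * h j, subset_closure ⟨(i, j), rfl⟩⟩

theorem quotientElt_inv_mul (h : Fin 3 → G) (l i j : Fin 3) :
    (quotientElt h l i)⁻¹ * quotientElt h l j = quotientElt h i j := by
  ext
  simp [quotientElt, mul_assoc]

theorem closure_range_quotientElt (h : Fin 3 → G) :
    closure (Set.range fun p : Fin 3 × Fin 3 => quotientElt h p.1 p.2) = ⊤ := by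
  rw [← closure_closure_coe_preimage]
  congr 1
  ext ⟨x, hx⟩
  simp [quotientElt]

instance (h : Fin 3 → G) : Group.FG (quotientSubgroup h) :=
  (Group.fg_iff_subgroup_fg _).2 ((fg_iff _).2 ⟨_, rfl, Set.finite_range _⟩)

/-- Choose `b ∈ B` of maximal `φ`-degree within one coset of the subgroup. The product `h j * b`
must equal some `h i * b'` with `b' ∈ B` and `i ≠ j`, and then `b'` has larger degree. -/
theorem not_forall_pos {h : Fin 3 → G} {B : Finset G} (hB : B.Nonempty)
    (hcov : ∀ i, ∀ b ∈ B, ∃ j ≠ i, (h j)⁻¹ * h i * b ∈ B)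
    (φ : quotientSubgroup h →* Multiplicative ℤ) (j : Fin 3) :
    ¬ ∀ i ≠ j, 0 < (φ (quotientElt h i j)).toAdd := by
  classical
  intro hpos
  obtain ⟨b₀, hb₀⟩ := hB
  -- The degree on the right coset of `b₀`; the value `0` elsewhere plays no role, as the maximum is
  -- taken over this coset only.
  let d : G → ℤ := fun b =>
    if hb : b * b₀⁻¹ ∈ quotientSubgroup h then (φ ⟨_, hb⟩).toAdd else 0
  obtain ⟨b, hb, hmax⟩ := (B.filter fun b => b * b₀⁻¹ ∈ quotientSubgroup h).exists_max_image d
    ⟨b₀, by simp [hb₀]⟩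
  rw [Finset.mem_filter] at hb
  obtain ⟨i, hij, hi⟩ := hcov j b hb.1
  have hmem : (h i)⁻¹ * h j * b * b₀⁻¹ ∈ quotientSubgroup h := by
    rw [mul_assoc]; exact mul_mem (quotientElt h i j).2 hb.2
  have hle := hmax _ (Finset.mem_filter.2 ⟨hi, hmem⟩)
  have heq : (⟨_, hmem⟩ : quotientSubgroup h) = quotientElt h i j * ⟨_, hb.2⟩ := by
    ext; simp [quotientElt, mul_assoc]
  simp only [d, dif_pos hmem, dif_pos hb.2, heq, map_mul, toAdd_mul] at hle
  have := hpos i hij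
  omega

theorem monoidHom_eq_one_of_cover {h : Fin 3 → G} {B : Finset G} (hB : B.Nonempty)
    (hcov : ∀ i, ∀ b ∈ B, ∃ j ≠ i, (h j)⁻¹ * h i * b ∈ B)
    (φ : quotientSubgroup h →* Multiplicative ℤ) : φ = 1 := by
  set v : Fin 3 → ℤ := fun i => (φ (quotientElt h 0 i)).toAdd with hv
  have hφ : ∀ i j, (φ (quotientElt h i j)).toAdd = v j - v i := by
    intro i j
    rw [← quotientElt_inv_mul h 0, map_mul, map_inv, toAdd_mul, toAdd_inv]
    ring
  have hmax := not_forall_pos hB hcov φ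
  have hmin := not_forall_pos hB hcov φ⁻¹
  simp only [MonoidHom.inv_apply, toAdd_inv, hφ] at hmax hmin
  -- Among three values the maximum and the minimum are each attained at least twice, so they
  -- coincide.
  have hconst : ∀ i j, v i = v j := by
    have h0 := hmax 0; have h1 := hmax 1; have h2 := hmax 2
    have h0' := hmin 0; have h1' := hmin 1; have h2' := hmin 2
    simp [Fin.forall_fin_succ] at h0 h1 h2 h0' h1' h2' ⊢
    omega
  refine MonoidHom.eq_of_eqOn_dense (closure_range_quotientElt h) ?_
  rintro _ ⟨⟨i, j⟩, rfl⟩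
  apply Multiplicative.toAdd.injective
  simp [hφ, hconst j i]

theorem torsionFreeTorsionAb_quotientSubgroup (hG : TorsionFreeGroup G) {h : Fin 3 → G}
    {B : Finset G} (hB : B.Nonempty) (hcov : ∀ i, ∀ b ∈ B, ∃ j ≠ i, (h j)⁻¹ * h i * b ∈ B) :
    TorsionFreeTorsionAb (quotientSubgroup h) where
  eq_one_of_pow g n hn hg := by
    ext
    refine hG _ (isOfFinOrder_iff_pow_eq_one.2 ⟨n, hn, ?_⟩)
    exact_mod_cast congrArg Subtype.val hg
  exists_pow_mem := exists_pow_mem_commutator (monoidHom_eq_one_of_cover hB hcov)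

end Indicable

/-! ### Colours of the edges of the zero-divisor graph -/

theorem exists_enum_support {G : Type*} [Group G] {α β : MonoidAlgebra (ZMod 2) G}
    (hα : α.coeff.support.card = 3) (hαβ : α * β = 0) :
    ∃ h : Fin 3 → G, Function.Injective h ∧ (∀ g ∈ α.coeff.support, ∃ i, h i = g) ∧
      ∀ x, ∑ i, β.coeff ((h i)⁻¹ * x) = 0 := by
  classical
  let e := Finset.equivFinOfCardEq hα
  have hinj : Function.Injective fun i => (e.symm i : G) :=
    Subtype.val_injective.comp e.symm.injective
  refine ⟨fun i => e.symm i, hinj, fun g hg => ⟨e ⟨g, hg⟩, by simp⟩, fun x => ?_⟩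
  have hone : ∀ z : ZMod 2, z ≠ 0 → z = 1 := by decide
  have hsum : α = ∑ i, MonoidAlgebra.single (e.symm i : G) (1 : ZMod 2) := by
    ext g
    rw [MonoidAlgebra.coeff_sum, Finsupp.finsetSum_apply]
    simp only [MonoidAlgebra.coeff_single, Finsupp.single_apply]
    by_cases hg : g ∈ α.coeff.support
    · rw [Finset.sum_eq_single (e ⟨g, hg⟩)]
      · simpa using hone _ (Finsupp.mem_support_iff.1 hg)
      · intro i _ hi
        rw [if_neg]
        rintro rfl
        simp at hi
      · simp
    · rw [Finsupp.notMem_support_iff.1 hg, Finset.sum_eq_zero]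
      intro i _
      rw [if_neg]
      rintro rfl
      exact hg (e.symm i).2
  have h0 := congrArg (fun f : MonoidAlgebra (ZMod 2) G => f.coeff x) hαβ
  simp only [hsum, Finset.sum_mul, MonoidAlgebra.coeff_sum, Finsupp.finsetSum_apply,
    MonoidAlgebra.coeff_single_mul_apply, one_mul] at h0
  simpa using h0

section Cover

variable {G : Type*} [Group G] {h : Fin 3 → G} {f : G →₀ ZMod 2}

theorem exists_other_of_sum_eq_zero (hsum : ∀ x, ∑ i, f ((h i)⁻¹ * x) = 0) (i : Fin 3) (b : G)
    (hb : b ∈ f.support) : ∃ j ≠ i, (h j)⁻¹ * h i * b ∈ f.support := by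
  by_contra! hcon
  have := hsum (h i * b)
  rw [Finset.sum_eq_single i] at this
  · rw [inv_mul_cancel_left] at this
    exact Finsupp.mem_support_iff.1 hb this
  · intro j _ hj
    simpa [mul_assoc] using hcon j hj
  · simp

/-- Three ones do not sum to zero modulo 2. This parity makes neighbours unique. -/
theorem not_forall_mem_of_sum_eq_zero (hsum : ∀ x, ∑ i, f ((h i)⁻¹ * x) = 0) (x : G) :
    ¬ ∀ i, (h i)⁻¹ * x ∈ f.support := by
  intro hall
  have hone : ∀ z : ZMod 2, z ≠ 0 → z = 1 := by decide
  have h1 : ∀ i, f ((h i)⁻¹ * x) = 1 := fun i => hone _ (Finsupp.mem_support_iff.1 (hall i))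
  have := hsum x
  simp only [h1, Fin.sum_univ_three] at this
  exact absurd this (by decide)

/-- A colour of `g` determines the corresponding neighbour. -/
theorem neighbour_unique (hsum : ∀ x, ∑ i, f ((h i)⁻¹ * x) = 0) {g g₁ g₂ : G} (hg : g ∈ f.support)
    (hg₁ : g₁ ∈ f.support) (hg₂ : g₂ ∈ f.support) (hne₁ : g ≠ g₁) (hne₂ : g ≠ g₂) {i j₁ j₂ : Fin 3}
    (h₁ : h i * g = h j₁ * g₁) (h₂ : h i * g = h j₂ * g₂) : g₁ = g₂ := by
  by_contra hne
  refine not_forall_mem_of_sum_eq_zero hsum (h i * g) fun l => ?_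
  have hi₁ : i ≠ j₁ := by rintro rfl; exact hne₁ (mul_left_cancel h₁)
  have hi₂ : i ≠ j₂ := by rintro rfl; exact hne₂ (mul_left_cancel h₂)
  have hj : j₁ ≠ j₂ := by rintro rfl; exact hne (mul_left_cancel (h₁.symm.trans h₂))
  have hl : l = i ∨ l = j₁ ∨ l = j₂ := by omega
  rcases hl with rfl | rfl | rfl
  · rwa [inv_mul_cancel_left]
  · rwa [h₁, inv_mul_cancel_left]
  · rwa [h₂, inv_mul_cancel_left]

end Cover

/-! ### Periodic ladders -/

/-- The support of an element annihilated by an element with three terms carries no periodic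
ladder: two sequences `v · false` and `v · true` of vertices which are joined by rails and rungs. -/
theorem no_periodic_ladder {G : Type*} [Group G] (hG : TorsionFreeGroup G) {h : Fin 3 → G}
    (hinj : Function.Injective h) {f : G →₀ ZMod 2} (hsum : ∀ x, ∑ i, f ((h i)⁻¹ * x) = 0)
    (v : ℕ → Bool → G) (hmem : ∀ i ε, v i ε ∈ f.support)
    (hrail : ∀ i ε, ∃ a b, h a * v i ε = h b * v (i + 1) ε)
    (hrung : ∀ i, ∃ a b, h a * v i false = h b * v i true)
    (hrung_ne : ∀ i ε, v i ε ≠ v i (!ε)) (hrail_ne : ∀ i ε, v i ε ≠ v (i + 1) ε)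
    (htwo_ne : ∀ i ε, v i ε ≠ v (i + 2) ε) (hdiag_ne : ∀ i ε, v i ε ≠ v (i + 1) (!ε))
    {N : ℕ} (hN : 0 < N) (hper : ∀ i, v (i + N) false = v i false) : False := by
  -- `p i ε` and `q i ε` are the colours of the rail from `v i ε` to `v (i + 1) ε` at its start and
  -- at its end; `r i` and `s i` are those of the rung at `v i false` and `v i true`.
  choose p q hpq using hrail
  choose r s hrs using hrung
  have hrs_ne : ∀ i, r i ≠ s i := fun i hi => by
    have := hrs i
    rw [hi] at this
    exact hrung_ne i false (mul_left_cancel this)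
  have hpq_ne : ∀ i ε, p i ε ≠ q i ε := fun i ε hi => by
    have := hpq i ε
    rw [hi] at this
    exact hrail_ne i ε (mul_left_cancel this)
  -- From here to `hsp`: two edges with the same colour at a vertex would lead to the same
  -- neighbour, but the neighbours along the ladder are distinct.
  have hqp : ∀ i ε, q i ε ≠ p (i + 1) ε := fun i ε hi => by
    have h1 := (hpq i ε).symm
    have h2 := hpq (i + 1) ε
    rw [← hi] at h2
    exact htwo_ne i ε (neighbour_unique hsum (hmem _ _) (hmem _ _) (hmem _ _)
      (hrail_ne i ε).symm (hrail_ne (i + 1) ε) h1 h2)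
  have hrq : ∀ i, r (i + 1) ≠ q i false := fun i hi => by
    have h1 := (hpq i false).symm
    have h2 := hrs (i + 1)
    rw [hi] at h2
    exact hdiag_ne i false (neighbour_unique hsum (hmem _ _) (hmem _ _) (hmem _ _)
      (hrail_ne i false).symm (hrung_ne (i + 1) false) h1 h2)
  have hsq : ∀ i, s (i + 1) ≠ q i true := fun i hi => by
    have h1 := (hpq i true).symm
    have h2 := (hrs (i + 1)).symm
    rw [hi] at h2
    exact hdiag_ne i true (neighbour_unique hsum (hmem _ _) (hmem _ _) (hmem _ _)
      (hrail_ne i true).symm (hrung_ne (i + 1) true) h1 h2)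
  have hrp : ∀ i, r i ≠ p i false := fun i hi => by
    have h1 := hrs i
    have h2 := hpq i false
    rw [← hi] at h2
    exact hdiag_ne i true (neighbour_unique hsum (hmem _ _) (hmem _ _) (hmem _ _)
      (hrung_ne i false) (hrail_ne i false) h1 h2)
  have hsp : ∀ i, s i ≠ p i true := fun i hi => by
    have h1 := (hrs i).symm
    have h2 := hpq i true
    rw [← hi] at h2
    exact hdiag_ne i false (neighbour_unique hsum (hmem _ _) (hmem _ _) (hmem _ _)
      (hrung_ne i true) (hrail_ne i true) h1 h2)
  have hp : ∀ i, p (i + 1) false = -(r (i + 1) + q i false) := fun i =>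
    (third_eq (hrq i) (hrp (i + 1)) (hqp i false)).symm
  have hp' : ∀ i, p (i + 1) true = -(s (i + 1) + q i true) := fun i =>
    (third_eq (hsq i) (hsp (i + 1)) (hqp i true)).symm
  -- `S i` describes rung `i + 1`, since a state records the rails leading back from its rung.
  let S : ℕ → RungState := fun i => (r (i + 1), s (i + 1), q i false, q i true)
  have hvalid : ∀ i, (S i).Valid := fun i => ⟨hrs_ne _, (hrq i).symm, (hsq i).symm⟩
  have hstep : ∀ i, (S i).Step (S (i + 1)) := fun i =>
    ⟨hp i ▸ (hpq_ne (i + 1) false).symm, hp' i ▸ (hpq_ne (i + 1) true).symm⟩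
  -- Each factor is a quotient of two adjacent vertices, and the product around the square
  -- telescopes.
  have hsquare : ∀ i, pairWord (quotientElt h 0) ((S i).square (S (i + 1))) = 1 := fun i => by
    have h1 : (h (r (i + 1)))⁻¹ * h (s (i + 1)) = v (i + 1) false * (v (i + 1) true)⁻¹ := by
      rw [inv_mul_eq_iff_eq_mul, ← mul_assoc, hrs, mul_inv_cancel_right]
    have h2 : (h (s (i + 2)))⁻¹ * h (r (i + 2)) = v (i + 2) true * (v (i + 2) false)⁻¹ := by
      rw [inv_mul_eq_iff_eq_mul, ← mul_assoc, ← hrs, mul_inv_cancel_right]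
    have h3 : (h (q (i + 1) false))⁻¹ * h (p (i + 1) false)
        = v (i + 2) false * (v (i + 1) false)⁻¹ := by
      rw [inv_mul_eq_iff_eq_mul, ← mul_assoc, ← hpq, mul_inv_cancel_right]
    have h4 : (h (p (i + 1) true))⁻¹ * h (q (i + 1) true)
        = v (i + 1) true * (v (i + 2) true)⁻¹ := by
      rw [inv_mul_eq_iff_eq_mul, ← mul_assoc, hpq, mul_inv_cancel_right]
    ext
    simp only [pairWord, RungState.square, S, ← hp, ← hp', List.map_cons, List.map_nil,
      List.prod_cons, List.prod_nil, mul_one, quotientElt_inv_mul, Subgroup.coe_mul,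
      Subgroup.coe_one]
    simp only [quotientElt, h1, h2, h3, h4]
    group
  have hK := torsionFreeTorsionAb_quotientSubgroup hG (B := f.support) ⟨_, hmem 0 false⟩
    (exists_other_of_sum_eq_zero hsum)
  have hkinj : Function.Injective (quotientElt h 0) := fun i j hij =>
    hinj (mul_left_cancel (congrArg Subtype.val hij))
  have hgen : Subgroup.closure (Set.range fun p : Fin 3 × Fin 3 =>
      (quotientElt h 0 p.1)⁻¹ * quotientElt h 0 p.2) = ⊤ := by
    simpa only [quotientElt_inv_mul] using closure_range_quotientElt h
  have hconst : ∀ i, S i = S 0 := by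
    intro i
    induction i with
    | zero => rfl
    | succ i ih =>
      rw [← ih]
      exact (RungState.eq_of_square_eq_one hK hkinj hgen (hvalid i) (hvalid (i + 1))
        (hvalid (i + 2)) (hstep i) (hstep (i + 1)) (hsquare i) (hsquare (i + 1))).symm
  have hq : ∀ i, q i false = q 0 false := fun i =>
    congrArg (fun T : RungState => T.2.2.1) (hconst i)
  have hr : ∀ i, r (i + 1) = r 1 := fun i => congrArg (fun T : RungState => T.1) (hconst i)
  have hp1 : ∀ i, p (i + 1) false = p 1 false := fun i => by rw [hp, hp, hq, hr]
  -- Constant colours make every step along this rail, from rung 1 on, left multiplication by the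
  -- same element.
  have hpow : ∀ n, v (1 + n) false = ((h (q 1 false))⁻¹ * h (p 1 false)) ^ n * v 1 false := by
    intro n
    induction n with
    | zero => simp
    | succ n ih =>
      have h1 := hpq (n + 1) false
      rw [hp1, hq, ← hq 1, add_comm n 1, ih, ← inv_mul_eq_iff_eq_mul] at h1
      rw [← add_assoc, ← h1, pow_succ']
      group
  have hone : ((h (q 1 false))⁻¹ * h (p 1 false)) ^ N = 1 := by
    have := hpow N
    rwa [hper, right_eq_mul] at this
  have := hG _ (isOfFinOrder_iff_pow_eq_one.2 ⟨N, hN, hone⟩)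
  exact hpq_ne 1 false (hinj (inv_mul_eq_one.1 this)).symm

/-! ### Unrolling the ladders -/

/-- A periodic sequence of rungs in a simple graph. -/
structure LadderCover {V : Type*} (Γ : SimpleGraph V) where
  /-- the two vertices of the `i`-th rung -/
  vert : ℕ → Bool → V
  period : ℕ
  period_pos : 0 < period
  vert_add_period : ∀ i, vert (i + period) false = vert i false
  adj_rail : ∀ i ε, Γ.Adj (vert i ε) (vert (i + 1) ε)
  adj_rung : ∀ i ε, Γ.Adj (vert i ε) (vert i (!ε))
  ne_two : ∀ i ε, vert i ε ≠ vert (i + 2) ε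
  ne_diag : ∀ i ε, vert i ε ≠ vert (i + 1) (!ε)

theorem add_mod_ne {m i j : ℕ} (hj : 0 < j) (hjm : j < m) : i % m ≠ (i + j) % m := by
  intro h
  have h1 : i + 0 ≡ i + j [MOD m] := h
  have h2 := Nat.ModEq.add_left_cancel' i h1
  rw [Nat.ModEq, Nat.zero_mod, Nat.mod_eq_of_lt hjm] at h2
  omega

/-- The quotient `i / m` counts completed turns around the ladder; it changes exactly at a closing
edge. -/
theorem succ_mod_cases {m : ℕ} (hm : 0 < m) (i : ℕ) :
    (i % m + 1 = (i + 1) % m ∧ (i + 1) / m = i / m) ∨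
      (i % m + 1 = m ∧ (i + 1) % m = 0 ∧ (i + 1) / m = i / m + 1) := by
  rcases Nat.lt_or_ge (i % m + 1) m with h | h
  · left
    have h1 : i + 1 = i % m + 1 + m * (i / m) := by have := Nat.mod_add_div i m; omega
    constructor
    · rw [h1, Nat.add_mul_mod_self_left, Nat.mod_eq_of_lt h]
    · rw [h1, Nat.add_mul_div_left _ _ hm, Nat.div_eq_of_lt h, zero_add]
  · right
    have h2 := Nat.mod_lt i hm
    have h3 : i % m + 1 = m := by omega
    have h1 : i + 1 = m * (i / m + 1) := by have := Nat.mod_add_div i m; rw [mul_add]; omega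
    refine ⟨h3, ?_, ?_⟩
    · rw [h1, Nat.mul_mod_right]
    · rw [h1, Nat.mul_div_cancel_left _ hm]

/-- The circular ladder, unrolled. -/
def circularLadderCover {m : ℕ} (hm : 3 ≤ m) : LadderCover (circularLadder m) where
  vert i ε := (⟨i % m, Nat.mod_lt i (by omega)⟩, ε)
  period := m
  period_pos := by omega
  vert_add_period i := by simp
  adj_rail i ε := by
    have h1 := add_mod_ne (i := i) (j := 1) (m := m) (by omega) (by omega)
    have h2 := succ_mod_cases (m := m) (by omega) i
    simp only [circularLadder, SimpleGraph.fromRel_adj]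
    refine ⟨fun h => h1 (congrArg (fun u : Fin m × Bool => u.1.val) h), Or.inl (Or.inr ?_)⟩
    rcases h2 with h2 | h2
    · exact Or.inl ⟨h2.1, trivial⟩
    · exact Or.inr ⟨h2.1, h2.2.1, trivial⟩
  adj_rung i ε := by simp [circularLadder]
  ne_two i ε h := add_mod_ne (i := i) (j := 2) (m := m) (by omega) (by omega)
    (congrArg (fun u : Fin m × Bool => u.1.val) h)
  ne_diag i ε h := add_mod_ne (i := i) (j := 1) (m := m) (by omega) (by omega)
    (congrArg (fun u : Fin m × Bool => u.1.val) h)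

/-- The Möbius ladder, unrolled: each turn interchanges the two rails. -/
def moebiusLadderCover {m : ℕ} (hm : 2 ≤ m) : LadderCover (moebiusLadder m) where
  vert i ε := (⟨i % m, Nat.mod_lt i (by omega)⟩, xor ε (Nat.bodd (i / m)))
  period := m * 2
  period_pos := by omega
  vert_add_period i := by
    have : (i + m * 2) / m = i / m + 2 := Nat.add_mul_div_left _ _ (by omega)
    simp [this]
  adj_rail i ε := by
    have h1 := add_mod_ne (i := i) (j := 1) (m := m) (by omega) (by omega)
    have h2 := succ_mod_cases (m := m) (by omega) i
    simp only [moebiusLadder, SimpleGraph.fromRel_adj]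
    refine ⟨fun h => h1 (congrArg (fun u : Fin m × Bool => u.1.val) h), Or.inl (Or.inr ?_)⟩
    rcases h2 with h2 | h2
    · exact Or.inl ⟨h2.1, by rw [h2.2]⟩
    · exact Or.inr ⟨h2.1, h2.2.1, by rw [h2.2.2, Nat.bodd_succ]; simp⟩
  adj_rung i ε := by simp [moebiusLadder]
  ne_two i ε h := by
    rcases Nat.lt_or_ge 2 m with h3 | h3
    · exact add_mod_ne (i := i) (j := 2) (m := m) (by omega) h3
        (congrArg (fun u : Fin m × Bool => u.1.val) h)
    -- Two steps now return to the same rung, but after one twist, hence to its other end.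
    · obtain rfl : m = 2 := by omega
      have h4 := congrArg (fun u : Fin 2 × Bool => u.2) h
      have h5 : (i + 2) / 2 = i / 2 + 1 := by omega
      simp [h5] at h4
  ne_diag i ε h := add_mod_ne (i := i) (j := 1) (m := m) (by omega) (by omega)
    (congrArg (fun u : Fin m × Bool => u.1.val) h)

theorem isEmpty_isomorphism_of_ladderCover {G : Type*} [Group G] (hG : TorsionFreeGroup G)
    {α β : MonoidAlgebra (ZMod 2) G} (hα : α.coeff.support.card = 3) (hαβ : α * β = 0)
    {V : Type*} {Γ : SimpleGraph V} (L : LadderCover Γ) :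
    IsEmpty ((zeroDivisorGraph α β).Isomorphism (Graph.ofSimpleGraph Γ)) := by
  refine ⟨fun φ => ?_⟩
  obtain ⟨h, hinj, hsupp, hsum⟩ := exists_enum_support hα hαβ
  let ψ : V → (zeroDivisorGraph α β).vertexSet := fun u => φ.onVertices.symm ⟨u, Set.mem_univ u⟩
  have hψ : ∀ {u w}, (ψ u : G) = ψ w → u = w := fun {u w} huw => by
    have := φ.onVertices.symm.injective (Subtype.ext huw)
    exact congrArg Subtype.val this
  have hadj : ∀ {u w}, Γ.Adj u w → ∃ a b, h a * (ψ u : G) = h b * (ψ w : G) := by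
    intro u w huw
    have h1 : (zeroDivisorGraph α β).Adj (ψ u) (ψ w) := by
      rw [← φ.adj_iff]
      simpa [ψ] using huw
    obtain ⟨_, _, _, _, g, hg, g', hg', heq, _⟩ := h1
    obtain ⟨a, rfl⟩ := hsupp g hg
    obtain ⟨b, rfl⟩ := hsupp g' hg'
    exact ⟨a, b, heq⟩
  exact no_periodic_ladder hG hinj hsum (fun i ε => (ψ (L.vert i ε) : G))
    (fun i ε => (ψ (L.vert i ε)).2) (fun i ε => hadj (L.adj_rail i ε))
    (fun i => hadj (L.adj_rung i false)) (fun i ε he => (L.adj_rung i ε).ne (hψ he))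
    (fun i ε he => (L.adj_rail i ε).ne (hψ he)) (fun i ε he => L.ne_two i ε (hψ he))
    (fun i ε he => L.ne_diag i ε (hψ he)) L.period_pos
    (fun i => by simp only [L.vert_add_period])

theorem mainTheorem8 {G : Type*} [Group G] (hG : TorsionFreeGroup G)
    (α β : MonoidAlgebra (ZMod 2) G)
    (hα : α.coeff.support.card = 3) (hβ : β ≠ 0) (hαβ : α * β = 0)
    (hmin : ∀ β' : MonoidAlgebra (ZMod 2) G, β' ≠ 0 → α * β' = 0 →
      β.coeff.support.card ≤ β'.coeff.support.card) :
    (∀ m : ℕ, 3 ≤ m →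
      IsEmpty ((zeroDivisorGraph α β).Isomorphism (Graph.ofSimpleGraph (circularLadder m)))) ∧
    (∀ m : ℕ, 2 ≤ m →
      IsEmpty ((zeroDivisorGraph α β).Isomorphism (Graph.ofSimpleGraph (moebiusLadder m)))) :=
  ⟨fun _ hm => isEmpty_isomorphism_of_ladderCover hG hα hαβ (circularLadderCover hm),
    fun _ hm => isEmpty_isomorphism_of_ladderCover hG hα hαβ (moebiusLadderCover hm)⟩
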